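/- **Corollary 4.5 (Brauer–Thrall I).** Let $\mathcal A$ be an abelian length category, i.e. an abelian category in which every object $X$ has a finite composition series $0=X_0\subseteq X_1\subseteq\dots\subseteq X_m=X$ with all quotients $X_i/X_{i-1}$ simple, and whose isomorphism classes of objects form a set; write $\ell(X)=m$ for the length of $X$. Call a nonzero object $X$ indecomposable if $X\cong X_1\oplus X_2$ implies $X_1=0$ or $X_2=0$, and call a morphism $\varphi\colon X\to Y$ left almost split if $\varphi$ is not a split monomorphism and every morphism $X\to Y'$ in $\mathcal A$ that is not a split monomorphism factors through $\varphi$. Suppose that 1. there are infinitely many isomorphism classes of indecomposable objects in $\mathcal A$, 2. there are only finitely many isomorphism classes of simple objects in $\mathcal A$, and 3. for every indecomposable object $X$ of $\mathcal A$ there exists a left almost split morphism $X\to Y$ in $\mathcal A$. Then for every $n\in\mathbb N$ there exists an indecomposable object $X\in\mathcal A$ with $\ell(X)>n$. -/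

import Mathlib

open CategoryTheory CategoryTheory.Limits

universe v u

namespace BrauerThrall

section Definitions

variable {C : Type u} [Category.{v} C] [Abelian C]

/-- `X` has a composition series `0 = X₀ ⊆ X₁ ⊆ ... ⊆ Xₙ = X` of subobjects with exactly `n` steps:
each quotient `Xᵢ₊₁ / Xᵢ`, that is, the cokernel of the inclusion `Xᵢ ⟶ Xᵢ₊₁`, is simple. -/
def HasCompositionSeries (X : C) (n : ℕ) : Prop :=
  ∃ (s : Fin (n + 1) → Subobject X) (le : ∀ i : Fin n, s i.castSucc ≤ s i.succ),
    s 0 = ⊥ ∧ s (Fin.last n) = ⊤ ∧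
      ∀ i : Fin n, Simple (cokernel (Subobject.ofLE (s i.castSucc) (s i.succ) (le i)))

/-- `X` has finite length if it has a finite composition series. -/
def HasFiniteLength (X : C) : Prop :=
  ∃ n : ℕ, HasCompositionSeries X n

/-- The length `ℓ(X)` of an object of finite length: the number of steps of a composition series.
All composition series of `X` have equally many steps (Jordan–Hölder), so the least such number
is the common one. -/
noncomputable def length (X : C) : ℕ :=
  sInf {n : ℕ | HasCompositionSeries X n}

/-- A morphism `φ : X ⟶ Y` is left almost split if it is not a split monomorphism and every
morphism starting at `X` that is not a split monomorphism factors through `φ`. -/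
def IsLeftAlmostSplit {X Y : C} (φ : X ⟶ Y) : Prop :=
  ¬ IsSplitMono φ ∧
    ∀ (Z : C) (f : X ⟶ Z), ¬ IsSplitMono f → ∃ g : Y ⟶ Z, φ ≫ g = f

variable (C)

/-- An abelian category is a length category if all its objects have finite length. (That the
isomorphism classes of objects form a set is automatic: the objects form a type `C : Type u`,
and the isomorphism classes are a quotient of it. No restriction on `u` and `v` is needed.) -/
def IsLengthCategory : Prop :=
  ∀ X : C, HasFiniteLength X

/-- The set of isomorphism classes of indecomposable objects. -/
def ind : Set (Quotient (isIsomorphicSetoid C)) :=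
  {c | ∃ X : C, Indecomposable X ∧ Quotient.mk (isIsomorphicSetoid C) X = c}

/-- The set of isomorphism classes of simple objects. -/
def simpleClasses : Set (Quotient (isIsomorphicSetoid C)) :=
  {c | ∃ X : C, Simple X ∧ Quotient.mk (isIsomorphicSetoid C) X = c}

end Definitions

end BrauerThrall

namespace BrauerThrall

/-! ### Length measured by chains of subobjects -/

section Lattice

variable {C : Type u} [Category.{v} C]

/-! Suppose all indecomposables have length at most `n`. By Harada–Sai, long compositions of
non-isomorphisms between indecomposables vanish. But a nonzero map from a simple `T` to an
indecomposable `X` not isomorphic to `T` factors through a left almost split map `T ⟶ Y`, hence is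
nonzero through some indecomposable summand of `Y`. Iterating gives arbitrarily long nonzero
compositions, unless `X` lies in a finite set of classes met on the way. So almost every `X`
receives no nonzero map from `T`. Every indecomposable has a simple subobject and there are finitely
many simples, so there are finitely many indecomposables.

Sizes are compared through `chainLength`, which is monotone and self-dual; only `chainLength ≤
length` is needed, so Jordan–Hölder is avoided. -/

lemma le_iff_factors_arrow {X : C} (x y : Subobject X) : x ≤ y ↔ y.Factors x.arrow :=
  ⟨fun h => Subobject.factors_of_le _ h (Subobject.factors_self x),
    fun h => Subobject.le_of_comm (y.factorThru _ h) (y.factorThru_arrow _ h)⟩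

/-- The length of a longest chain of subobjects of `X`. -/
noncomputable def chainLength (X : C) : ℕ∞ :=
  Order.height (⊤ : Subobject X)

lemma chainLength_le_height_mk {X Y : C} (f : X ⟶ Y) [Mono f] :
    chainLength X ≤ Order.height (Subobject.mk f) := by
  rw [← Subobject.map_top f]
  exact Order.height_le_height_apply_of_strictMono _
    ((Subobject.map f).monotone.strictMono_of_injective (Subobject.map_obj_injective f)) _

lemma chainLength_le_of_mono {X Y : C} (f : X ⟶ Y) [Mono f] : chainLength X ≤ chainLength Y :=
  (chainLength_le_height_mk f).trans (Order.height_mono le_top)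

lemma isIso_of_mono_of_chainLength_le {X Y : C} (f : X ⟶ Y) [Mono f] (hX : chainLength X ≠ ⊤)
    (h : chainLength Y ≤ chainLength X) : IsIso f := by
  rw [Subobject.isIso_iff_mk_eq_top]
  by_contra hne
  have e : chainLength X = Order.height (Subobject.mk f) :=
    (chainLength_le_height_mk f).antisymm ((Order.height_mono le_top).trans h)
  have := Order.height_strictMono (lt_top_iff_ne_top.2 hne) (e ▸ lt_top_iff_ne_top.2 hX)
  exact absurd (e ▸ h) (not_le_of_gt this)

lemma chainLength_eq_of_iso {X Y : C} (e : X ≅ Y) : chainLength X = chainLength Y :=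
  (chainLength_le_of_mono e.hom).antisymm (chainLength_le_of_mono e.inv)

variable [Abelian C]

lemma factors_iff_comp_cokernel_eq_zero {X Z : C} (x : Subobject X) (f : Z ⟶ X) :
    x.Factors f ↔ f ≫ cokernel.π x.arrow = 0 := by
  constructor
  · intro h
    rw [← x.factorThru_arrow f h, Category.assoc, cokernel.condition, comp_zero]
  · intro h
    exact (Subobject.factors_iff _ _).2 ⟨Abelian.monoLift (C := C) x.arrow f h,
      Abelian.monoLift_comp (C := C) x.arrow f h⟩

lemma factors_of_epi_comp {X Z W : C} (x : Subobject X) (p : W ⟶ Z) [Epi p] (f : Z ⟶ X)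
    (h : x.Factors (p ≫ f)) : x.Factors f := by
  rw [factors_iff_comp_cokernel_eq_zero] at h ⊢
  rw [← cancel_epi p, ← Category.assoc, h, comp_zero]

/-- If `t / s` is simple and `x ≤ y` agree on `s`, but `x` is strictly larger on `t` than on `s`,
then `x` and `y` agree on `t`. -/
lemma inf_eq_inf_of_simple_cokernel {X : C} {s t x y : Subobject X} (hst : s ≤ t) (hxy : x ≤ y)
    (hsimple : Simple (cokernel (Subobject.ofLE s t hst))) (hs : s ⊓ x = s ⊓ y)
    (hx : s ⊓ x ≠ t ⊓ x) : t ⊓ x = t ⊓ y := by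
  refine le_antisymm (inf_le_inf_left t hxy) (le_inf inf_le_left ?_)
  set q := cokernel.π (Subobject.ofLE s t hst)
  have factors_s : ∀ {Z : C} (f : Z ⟶ (t : C)), f ≫ q = 0 → s.Factors (f ≫ t.arrow) := by
    intro Z f hf
    refine (Subobject.factors_iff _ _).2 ⟨Abelian.monoLift (Subobject.ofLE s t hst) f hf, ?_⟩
    change _ ≫ s.arrow = _
    rw [← Subobject.ofLE_arrow hst, ← Category.assoc, Abelian.monoLift_comp]
  set a := Subobject.ofLE (t ⊓ x) t inf_le_left
  set b := Subobject.ofLE (t ⊓ y) t inf_le_left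
  have ha : a ≫ q ≠ 0 := by
    intro h
    refine hx (le_antisymm (inf_le_inf_right x hst) (le_inf ?_ inf_le_right))
    have := factors_s a h
    rwa [Subobject.ofLE_arrow, ← le_iff_factors_arrow] at this
  have : Epi (a ≫ q) := epi_of_nonzero_to_simple ha
  -- As `t ⊓ x` covers the simple quotient `t / s`, an "element" of `t ⊓ y` can be corrected by one
  -- of `t ⊓ x` to lie in `s ⊓ y = s ⊓ x`.
  obtain ⟨A, π, hπ, c, hc⟩ := surjective_up_to_refinements_of_epi (a ≫ q) (b ≫ q)
  rw [le_iff_factors_arrow]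
  refine factors_of_epi_comp x π _ ?_
  have hd : s.Factors ((π ≫ b - c ≫ a) ≫ t.arrow) := by
    apply factors_s
    rw [Preadditive.sub_comp, Category.assoc, Category.assoc, hc, sub_self]
  have e : (π ≫ b - c ≫ a) ≫ t.arrow = π ≫ (t ⊓ y).arrow - c ≫ (t ⊓ x).arrow := by
    rw [Preadditive.sub_comp, Category.assoc, Category.assoc, Subobject.ofLE_arrow,
      Subobject.ofLE_arrow]
  rw [e] at hd
  have hcx : x.Factors (c ≫ (t ⊓ x).arrow) :=
    Subobject.factors_of_factors_right _ (Subobject.inf_arrow_factors_right t x)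
  have hdy : y.Factors (π ≫ (t ⊓ y).arrow - c ≫ (t ⊓ x).arrow) := by
    have h1 : y.Factors (π ≫ (t ⊓ y).arrow) :=
      Subobject.factors_of_factors_right _ (Subobject.inf_arrow_factors_right t y)
    have h2 := Subobject.factors_of_le _ hxy hcx
    rw [factors_iff_comp_cokernel_eq_zero] at h1 h2 ⊢
    rw [Preadditive.sub_comp, h1, h2, sub_self]
  have hdx : x.Factors (π ≫ (t ⊓ y).arrow - c ≫ (t ⊓ x).arrow) := by
    refine Subobject.factors_of_le _ (inf_le_right : s ⊓ x ≤ x) ?_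
    rw [hs]
    exact (Subobject.inf_factors _).2 ⟨hd, hdy⟩
  have := Subobject.factors_add _ _ hdx hcx
  rwa [sub_add_cancel] at this

-- Let `S x` be the set of steps of the series at which `x` grows. By simplicity of the factors, `x
-- ≤ y` with `S x = S y` forces `x = y`, so the size of `S` strictly increases along chains.
open Classical in
lemma chainLength_le_of_hasCompositionSeries {X : C} {n : ℕ} (h : HasCompositionSeries X n) :
    chainLength X ≤ n := by
  obtain ⟨s, le, h0, h1, hsimple⟩ := h
  let S : Subobject X → Finset (Fin n) := fun x =>
    Finset.univ.filter fun i => s i.castSucc ⊓ x ≠ s i.succ ⊓ x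
  have hS : ∀ x y, x ≤ y → S x ⊆ S y := by
    intro x y hxy i hi
    simp only [S, Finset.mem_filter, Finset.mem_univ, true_and] at hi ⊢
    intro e
    apply hi
    rw [← inf_eq_right.2 hxy, ← inf_assoc, ← inf_assoc, e]
  have hstrict : StrictMono fun x => (S x).card := by
    intro x y hxy
    refine Finset.card_lt_card ((hS x y hxy.le).ssubset_of_ne fun e => hxy.ne ?_)
    have key : ∀ i : Fin (n + 1), s i ⊓ x = s i ⊓ y := by
      intro i
      induction i using Fin.induction with
      | zero => simp [h0]
      | succ i ih =>
        by_cases hi : i ∈ S x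
        · exact inf_eq_inf_of_simple_cokernel (le i) hxy.le (hsimple i) ih
            (by simpa [S] using hi)
        · have hi' : i ∉ S y := e ▸ hi
          simp only [S, Finset.mem_filter, Finset.mem_univ, true_and, not_not] at hi hi'
          rw [← hi, ← hi', ih]
    simpa [h1] using key (Fin.last n)
  calc chainLength X ≤ Order.height (S ⊤).card :=
        Order.height_le_height_apply_of_strictMono _ hstrict _
    _ = ((S ⊤).card : ℕ∞) := Order.height_nat _
    _ ≤ n := by
      have := Finset.card_le_univ (S ⊤)
      rw [Fintype.card_fin] at this
      exact_mod_cast this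

lemma chainLength_le_length (hC : IsLengthCategory C) (X : C) : chainLength X ≤ length X :=
  chainLength_le_of_hasCompositionSeries (Nat.sInf_mem (hC X))

lemma chainLength_ne_top (hC : IsLengthCategory C) (X : C) : chainLength X ≠ ⊤ :=
  ne_top_of_le_ne_top (ENat.natCast_ne_top _) (chainLength_le_length hC X)

lemma chainLength_op (X : C) : chainLength (Opposite.op X) = chainLength X := by
  have h := Order.krullDim_eq_of_orderIso (Abelian.subobjectIsoSubobjectOp X)
  rw [Order.krullDim_orderDual, ← Order.height_top_eq_krullDim,
    ← Order.height_top_eq_krullDim] at h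
  exact (WithBot.coe_injective h).symm

lemma chainLength_le_of_epi {X Y : C} (f : X ⟶ Y) [Epi f] : chainLength Y ≤ chainLength X := by
  rw [← chainLength_op X, ← chainLength_op Y]
  exact chainLength_le_of_mono f.op

lemma isIso_of_epi_of_chainLength_le {X Y : C} (f : X ⟶ Y) [Epi f] (hY : chainLength Y ≠ ⊤)
    (h : chainLength X ≤ chainLength Y) : IsIso f := by
  rw [← isIso_op_iff]
  rw [← chainLength_op X, ← chainLength_op Y] at h
  exact isIso_of_mono_of_chainLength_le f.op (by rwa [chainLength_op]) h

lemma chainLength_image_comp_eq {X Y Z : C} (f : X ⟶ Y) (g : Y ⟶ Z) :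
    chainLength (image (f ≫ g)) = chainLength (image (image.ι f ≫ g)) := by
  have e : f ≫ g = factorThruImage f ≫ (image.ι f ≫ g) := by rw [image.fac_assoc]
  rw [e]
  have : IsIso (image.preComp (factorThruImage f) (image.ι f ≫ g)) := isIso_of_mono_of_epi _
  exact chainLength_eq_of_iso (asIso (image.preComp (factorThruImage f) (image.ι f ≫ g)))

lemma chainLength_image_comp_le_left {X Y Z : C} (f : X ⟶ Y) (g : Y ⟶ Z) :
    chainLength (image (f ≫ g)) ≤ chainLength (image f) :=
  (chainLength_image_comp_eq f g).trans_le
    (chainLength_le_of_epi (factorThruImage (image.ι f ≫ g)))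

lemma chainLength_image_comp_le_right {X Y Z : C} (f : X ⟶ Y) (g : Y ⟶ Z) :
    chainLength (image (f ≫ g)) ≤ chainLength (image g) :=
  chainLength_le_of_mono (image.preComp f g)

end Lattice

/-! ### Indecomposables, the Harada–Sai lemma and almost split maps -/

section Indecomposable

variable {C : Type u} [Category.{v} C] [Abelian C]

lemma isIso_of_isSplitMono {X Y : C} (hY : Indecomposable Y) (hX : ¬ IsZero X) (f : X ⟶ Y)
    [IsSplitMono f] : IsIso f := by
  let b := isBilimitBinaryBiconeOfIsSplitMonoOfCokernel (cokernelIsCokernel f)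
  have h := (hY.2 X (cokernel f) (biprod.uniqueUpToIso _ _ b)).resolve_left hX
  have : Epi f := Preadditive.epi_of_cokernel_zero (h.eq_of_tgt _ _)
  exact isIso_of_mono_of_epi f

/-- If composing `f : X ⟶ Y` and `g : Y ⟶ Z` with `Y` indecomposable does not decrease the lengths
of the images, then `f` is an epimorphism and `g` is a monomorphism. -/
lemma epi_and_mono_of_chainLength_image_le (hC : IsLengthCategory C) {X Y Z : C}
    (hY : Indecomposable Y) (f : X ⟶ Y) (g : Y ⟶ Z) (hf0 : f ≠ 0)
    (hf : chainLength (image f) ≤ chainLength (image (f ≫ g)))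
    (hg : chainLength (image g) ≤ chainLength (image (f ≫ g))) : Epi f ∧ Mono g := by
  have : IsIso (factorThruImage (image.ι f ≫ g)) :=
    isIso_of_epi_of_chainLength_le _ (chainLength_ne_top hC _)
      (hf.trans_eq (chainLength_image_comp_eq f g))
  have hmono : Mono (image.ι f ≫ g) := by
    rw [← image.fac (image.ι f ≫ g)]
    infer_instance
  have : IsIso (image.preComp f g) :=
    isIso_of_mono_of_chainLength_le _ (chainLength_ne_top hC _) hg
  have hepi : Epi (f ≫ factorThruImage g) := by
    rw [← image.factorThruImage_preComp]
    infer_instance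
  have : Mono (image.ι f ≫ factorThruImage g) := by
    have : Mono ((image.ι f ≫ factorThruImage g) ≫ image.ι g) := by
      rwa [Category.assoc, image.fac]
    exact mono_of_mono _ (image.ι g)
  have : Epi (image.ι f ≫ factorThruImage g) := by
    have : Epi (factorThruImage f ≫ image.ι f ≫ factorThruImage g) := by
      rwa [image.fac_assoc]
    exact epi_of_epi (factorThruImage f) _
  -- The image of `f` maps isomorphically onto that of `g`, so it is a nonzero direct summand of
  -- `Y`, hence all of `Y`.
  have : IsIso (image.ι f ≫ factorThruImage g) := isIso_of_mono_of_epi _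
  have : IsSplitMono (image.ι f) := IsSplitMono.mk'
    { retraction := factorThruImage g ≫ inv (image.ι f ≫ factorThruImage g)
      id := by rw [← Category.assoc, IsIso.hom_inv_id] }
  have hI : ¬ IsZero (image f) := by
    intro h
    apply hf0
    rw [← image.fac f, h.eq_of_src (image.ι f) 0, comp_zero]
  have : IsIso (image.ι f) := isIso_of_isSplitMono hY hI _
  have : IsIso (factorThruImage g) := IsIso.of_isIso_comp_left (image.ι f) _
  constructor
  · rw [← image.fac f]
    infer_instance
  · rw [← image.fac g]
    infer_instance

/-- Compositions of `m` morphisms between indecomposable objects none of which is an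
isomorphism. -/
inductive RadicalComposition : ℕ → ∀ {X Y : C}, (X ⟶ Y) → Prop
  | id {X : C} (hX : Indecomposable X) : RadicalComposition 0 (𝟙 X)
  | cons {m : ℕ} {X Y Z : C} (hX : Indecomposable X) (f : X ⟶ Y) (g : Y ⟶ Z) (hf : ¬ IsIso f)
      (hg : RadicalComposition m g) : RadicalComposition (m + 1) (f ≫ g)

lemma RadicalComposition.indecomposable_left {m : ℕ} {X Y : C} {f : X ⟶ Y}
    (h : RadicalComposition m f) : Indecomposable X := by
  cases h <;> assumption

lemma RadicalComposition.indecomposable_right {m : ℕ} {X Y : C} {f : X ⟶ Y}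
    (h : RadicalComposition m f) : Indecomposable Y := by
  induction h <;> assumption

lemma RadicalComposition.exists_eq_comp {a b : ℕ} {X Z : C} {h : X ⟶ Z}
    (hh : RadicalComposition (a + b) h) :
    ∃ (Y : C) (f : X ⟶ Y) (g : Y ⟶ Z), RadicalComposition a f ∧ RadicalComposition b g ∧
      f ≫ g = h := by
  induction a generalizing X with
  | zero =>
    rw [Nat.zero_add] at hh
    exact ⟨X, 𝟙 X, h, .id hh.indecomposable_left, hh, Category.id_comp h⟩
  | succ a ih =>
    rw [Nat.add_right_comm] at hh
    cases hh with
    | cons hX u w hu hw =>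
      obtain ⟨Y, f, g, hf, hg, rfl⟩ := ih hw
      exact ⟨Y, u ≫ f, g, .cons hX u f hu hf, hg, Category.assoc _ _ _⟩

/-- The Harada–Sai lemma. -/
lemma RadicalComposition.eq_zero_or_chainLength_image_add_le (hC : IsLengthCategory C) {n : ℕ}
    (hn : ∀ X : C, Indecomposable X → chainLength X ≤ n) (k : ℕ) {X Y : C} {f : X ⟶ Y}
    (hf : RadicalComposition (2 ^ k - 1) f) : f = 0 ∨ chainLength (image f) + k ≤ n := by
  induction k generalizing X Y with
  | zero =>
    right
    simpa using (chainLength_le_of_mono (image.ι f)).trans (hn Y hf.indecomposable_right)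
  | succ k ih =>
    -- Two blocks of length `2 ^ k - 1` around one middle non-isomorphism `g`.
    have e : 2 ^ (k + 1) - 1 = (2 ^ k - 1) + ((2 ^ k - 1) + 1) := by
      have := Nat.one_le_two_pow (n := k)
      rw [pow_succ]
      omega
    rw [e] at hf
    obtain ⟨U, p, t, hp, ht, rfl⟩ := hf.exists_eq_comp
    cases ht with
    | cons hU g q hg hq =>
      by_cases hp0 : p = 0
      · exact .inl (by rw [hp0, zero_comp])
      by_cases hq0 : q = 0
      · exact .inl (by rw [hq0, comp_zero, comp_zero])
      by_cases h0 : p ≫ g ≫ q = 0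
      · exact .inl h0
      right
      by_contra hlt
      -- If the bound fails for `k + 1`, the image of the composite is already as long as the bound
      -- for `k` allows for those of `p` and `q`. Nothing is lost in composing, which makes `g ≫ q`
      -- mono and `p ≫ g` epi, so `g` is an isomorphism.
      have key : ∀ l : ℕ∞, l + k ≤ n → l ≤ chainLength (image (p ≫ g ≫ q)) := by
        intro l hl
        have hr := chainLength_ne_top hC (image (p ≫ g ≫ q))
        generalize chainLength (image (p ≫ g ≫ q)) = r at hlt hr ⊢
        lift r to ℕ using hr
        have hl' : l ≠ ⊤ := by
          rintro rfl
          simp at hl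
        lift l to ℕ using hl'
        norm_cast at hl hlt ⊢
        omega
      have hpr := key _ ((ih hp).resolve_left hp0)
      have hqr := key _ ((ih hq).resolve_left hq0)
      have hmono := (epi_and_mono_of_chainLength_image_le hC hU p (g ≫ q) hp0 hpr
        ((chainLength_image_comp_le_right g q).trans hqr)).2
      have hepi := (epi_and_mono_of_chainLength_image_le hC hq.indecomposable_left (p ≫ g) q
        (fun h => h0 (by rw [← Category.assoc, h, zero_comp]))
        (by rw [Category.assoc]; exact (chainLength_image_comp_le_left p g).trans hpr)
        (by rwa [Category.assoc])).1
      have : Mono g := mono_of_mono g q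
      have : Epi g := epi_of_epi p g
      exact hg (isIso_of_mono_of_epi g)

lemma RadicalComposition.eq_zero (hC : IsLengthCategory C) {n : ℕ}
    (hn : ∀ X : C, Indecomposable X → chainLength X ≤ n) {X Y : C} {f : X ⟶ Y}
    (hf : RadicalComposition (2 ^ (n + 1) - 1) f) : f = 0 := by
  -- With `k = n + 1` the second alternative is numerically impossible.
  refine (hf.eq_zero_or_chainLength_image_add_le hC hn (n + 1)).resolve_right fun h => ?_
  have : ((n + 1 : ℕ) : ℕ∞) ≤ n := le_add_self.trans h
  norm_cast at this
  omega

/-- The identity of `X` is a finite sum of morphisms factoring through indecomposable objects. -/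
lemma exists_sum_eq_id (hC : IsLengthCategory C) (X : C) :
    ∃ (ι : Type) (_ : Fintype ι) (Y : ι → C) (π : ∀ i, X ⟶ Y i) (σ : ∀ i, Y i ⟶ X),
      (∀ i, Indecomposable (Y i)) ∧ ∑ i, π i ≫ σ i = 𝟙 X := by
  induction hl : chainLength X using WellFoundedLT.induction generalizing X with
  | ind l ih =>
    by_cases h0 : IsZero X
    · exact ⟨Empty, inferInstance, fun i => i.elim, fun i => i.elim, fun i => i.elim,
        fun i => i.elim, h0.eq_of_src _ _⟩
    by_cases hX : Indecomposable X
    · exact ⟨Unit, inferInstance, fun _ => X, fun _ => 𝟙 X, fun _ => 𝟙 X, fun _ => hX, by simp⟩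
    simp only [Indecomposable, not_and, not_forall, not_or] at hX
    obtain ⟨A, B, e, hA, hB⟩ := hX h0
    -- Both summands are proper, hence strictly shorter, so the induction applies to them.
    have lt_of_mono : ∀ {W : C} (f : W ⟶ A ⊞ B) [Mono f], ¬ IsIso f → chainLength W < l := by
      intro W f _ hf
      rw [← hl, chainLength_eq_of_iso e]
      exact lt_of_not_ge fun h =>
        hf (isIso_of_mono_of_chainLength_le f (chainLength_ne_top hC W) h)
    have hinl : ¬ IsIso (biprod.inl : A ⟶ A ⊞ B) := fun h =>
      hB ((Biprod.isIso_inl_iff_isZero A B).1 h)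
    have hinr : ¬ IsIso (biprod.inr : B ⟶ A ⊞ B) := fun h => by
      apply hA
      rw [IsZero.iff_id_eq_zero, ← cancel_mono (biprod.inl : A ⟶ A ⊞ B),
        ← biprod.inl_fst (X := A) (Y := B)]
      have : (biprod.fst : A ⊞ B ⟶ A) = 0 := by
        rw [← cancel_epi (biprod.inr : B ⟶ A ⊞ B), biprod.inr_fst, comp_zero]
      simp [this]
    obtain ⟨I, _, Y, π, σ, hY, hs⟩ := ih _ (lt_of_mono _ hinl) A rfl
    obtain ⟨J, _, Y', π', σ', hY', hs'⟩ := ih _ (lt_of_mono _ hinr) B rfl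
    refine ⟨I ⊕ J, inferInstance, Sum.elim Y Y',
      fun i => match i with
        | .inl i => e.hom ≫ biprod.fst ≫ π i
        | .inr j => e.hom ≫ biprod.snd ≫ π' j,
      fun i => match i with
        | .inl i => σ i ≫ biprod.inl ≫ e.inv
        | .inr j => σ' j ≫ biprod.inr ≫ e.inv, ?_, ?_⟩
    · rintro (i | j)
      exacts [hY i, hY' j]
    · have h1 : ∑ i, (e.hom ≫ biprod.fst ≫ π i) ≫ σ i ≫ biprod.inl ≫ e.inv =
          e.hom ≫ biprod.fst ≫ (∑ i, π i ≫ σ i) ≫ biprod.inl ≫ e.inv := by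
        simp [Preadditive.sum_comp, Preadditive.comp_sum]
      have h2 : ∑ j, (e.hom ≫ biprod.snd ≫ π' j) ≫ σ' j ≫ biprod.inr ≫ e.inv =
          e.hom ≫ biprod.snd ≫ (∑ j, π' j ≫ σ' j) ≫ biprod.inr ≫ e.inv := by
        simp [Preadditive.sum_comp, Preadditive.comp_sum]
      rw [Fintype.sum_sum_type]
      refine (congrArg₂ (· + ·) h1 h2).trans ?_
      rw [hs, hs', Category.id_comp, Category.id_comp, ← Preadditive.comp_add,
        ← Category.assoc, ← Category.assoc (biprod.snd), ← Preadditive.add_comp, biprod.total,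
        Category.id_comp, e.hom_inv_id]

/-- Outside a finite set of isomorphism classes, a nonzero morphism `p ≫ f` into an indecomposable
object yields a nonzero composition of `p` with `m` non-isomorphisms. -/
lemma exists_finite_radicalComposition (hC : IsLengthCategory C)
    (hsplit : ∀ X : C, Indecomposable X → ∃ (Y : C) (φ : X ⟶ Y), IsLeftAlmostSplit φ)
    (m : ℕ) (A : C) (hA : Indecomposable A) :
    ∃ F : Set (Quotient (isIsomorphicSetoid C)), F.Finite ∧
      ∀ X : C, Indecomposable X → Quotient.mk (isIsomorphicSetoid C) X ∉ F →
        ∀ (Z : C) (p : Z ⟶ A) (f : A ⟶ X), p ≫ f ≠ 0 →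
          ∃ (B : C) (c : A ⟶ B), RadicalComposition m c ∧ p ≫ c ≠ 0 := by
  induction m generalizing A with
  | zero =>
    refine ⟨∅, Set.finite_empty, fun X _ _ Z p f h => ⟨A, 𝟙 A, .id hA, fun h0 => h ?_⟩⟩
    rw [Category.comp_id] at h0
    rw [h0, zero_comp]
  | succ m ih =>
    obtain ⟨Y, φ, hφ, hfac⟩ := hsplit A hA
    obtain ⟨ι, _, V, π, σ, hV, hs⟩ := exists_sum_eq_id hC Y
    choose F hF hF' using fun i => ih (V i) (hV i)
    -- Excluding the class of `A` ensures that no map `A ⟶ X` is a split monomorphism.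
    refine ⟨insert (Quotient.mk _ A) (⋃ i, F i), (Set.finite_iUnion hF).insert _, ?_⟩
    intro X hX hXF Z p f hpf
    rw [Set.mem_insert_iff, not_or, Set.mem_iUnion, not_exists] at hXF
    have hf : ¬ IsSplitMono f := fun _ =>
      have := isIso_of_isSplitMono hX hA.1 f
      hXF.1 (Quotient.sound ⟨(asIso f).symm⟩)
    obtain ⟨g, rfl⟩ := hfac X f hf
    obtain ⟨i, hi⟩ : ∃ i, (p ≫ φ ≫ π i) ≫ σ i ≫ g ≠ 0 := by
      by_contra! hall
      apply hpf
      have e : p ≫ φ ≫ g = ∑ i, (p ≫ φ ≫ π i) ≫ σ i ≫ g := by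
        calc p ≫ φ ≫ g = p ≫ φ ≫ (∑ i, π i ≫ σ i) ≫ g := by rw [hs, Category.id_comp]
          _ = _ := by simp [Preadditive.sum_comp, Preadditive.comp_sum]
      rw [e]
      exact Finset.sum_eq_zero fun i _ => hall i
    -- The prefix `p` records the path built so far, so that the whole composite, not just its last
    -- part, stays nonzero.
    obtain ⟨B, c, hc, hc0⟩ := hF' i X hX (hXF.2 i) Z (p ≫ φ ≫ π i) (σ i ≫ g) hi
    refine ⟨B, (φ ≫ π i) ≫ c, .cons hA _ c (fun _ => hφ ?_) hc, by simpa using hc0⟩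
    exact IsSplitMono.mk'
      { retraction := π i ≫ inv (φ ≫ π i)
        id := by rw [← Category.assoc, IsIso.hom_inv_id] }

lemma exists_simple_mono (hC : IsLengthCategory C) {X : C} (hX : ¬ IsZero X) :
    ∃ (S : C) (f : S ⟶ X), Simple S ∧ Mono f := by
  -- Finite heights give the descending chain condition, hence atoms.
  have hwf : WellFoundedLT (Subobject X) := by
    have hstrict : StrictMono fun x : Subobject X => Order.height x := fun x y hxy =>
      Order.height_strictMono hxy (lt_of_le_of_lt (Order.height_mono le_top)
        (lt_top_iff_ne_top.2 (chainLength_ne_top hC X)))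
    exact hstrict.wellFoundedLT
  have : Nontrivial (Subobject X) := Subobject.nontrivial_of_not_isZero hX
  obtain ⟨S, hS⟩ := IsAtomic.exists_atom (Subobject X)
  exact ⟨S, S.arrow, (subobject_simple_iff_isAtom S).2 hS, inferInstance⟩

end Indecomposable

end BrauerThrall

theorem corollary4p5 (C : Type u) [Category.{v} C] [Abelian C]
    (hlength : BrauerThrall.IsLengthCategory C)
    (hind : (BrauerThrall.ind C).Infinite)
    (hsimple : (BrauerThrall.simpleClasses C).Finite)
    (hsplit : ∀ X : C, Indecomposable X →
      ∃ (Y : C) (φ : X ⟶ Y), BrauerThrall.IsLeftAlmostSplit φ) :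
    ∀ n : ℕ, ∃ X : C, Indecomposable X ∧ n < BrauerThrall.length X := by
  intro n
  by_contra! hn
  have hn' : ∀ X : C, Indecomposable X → BrauerThrall.chainLength X ≤ n := fun X hX =>
    (BrauerThrall.chainLength_le_length hlength X).trans (by exact_mod_cast hn X hX)
  have key : ∀ c ∈ BrauerThrall.simpleClasses C,
      ∃ F : Set (Quotient (isIsomorphicSetoid C)), F.Finite ∧
        ∀ S X : C, Quotient.mk (isIsomorphicSetoid C) S = c → Indecomposable X →
          Quotient.mk (isIsomorphicSetoid C) X ∉ F → ∀ f : S ⟶ X, f = 0 := by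
    rintro c ⟨T, hT, rfl⟩
    obtain ⟨F, hF, h⟩ := BrauerThrall.exists_finite_radicalComposition hlength hsplit
      (2 ^ (n + 1) - 1) T (indecomposable_of_simple T)
    refine ⟨F, hF, fun S X hS hX hXF f => ?_⟩
    obtain ⟨e⟩ : IsIsomorphic S T := Quotient.exact hS
    by_contra hf
    -- Taking `e.hom` as prefix transfers the statement from the representative `T` to any `S` in
    -- its class.
    obtain ⟨B, c, hc, hc0⟩ := h X hX hXF S e.hom (e.inv ≫ f) (by simpa using hf)
    exact hc0 (by rw [hc.eq_zero hlength hn', comp_zero])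
  choose! F hF hF' using key
  refine hind ((hsimple.biUnion hF).subset ?_)
  rintro _ ⟨X, hX, rfl⟩
  obtain ⟨S, f, hS, hf⟩ := BrauerThrall.exists_simple_mono hlength hX.1
  have hSc : Quotient.mk (isIsomorphicSetoid C) S ∈ BrauerThrall.simpleClasses C := ⟨S, hS, rfl⟩
  by_contra hXF
  have hf0 := hF' _ hSc S X rfl hX (fun h => hXF (Set.mem_biUnion hSc h)) f
  exact Simple.not_isZero S (IsZero.of_mono_eq_zero f hf0)
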